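/- Let $B_r(x)$ denote the Bernoulli polynomials, defined by $\frac{te^{xt}}{e^t-1}=\sum_{r\ge 0}B_r(x)\frac{t^r}{r!}$, and for $n\ge 1$ let $$B_n^*(x)=\sum_{r=0}^{n}\binom{n+r}{2r}\frac{B_r(x)}{n+r}$$ be the Zagier polynomials. Let $x\in\mathbb{R}$, and assume that the sequence $\{B^*_{2n+1}(x)\}_{n\ge 0}$ is periodic, i.e. there is an integer $p\ge 1$ with $B^*_{2(n+p)+1}(x)=B^*_{2n+1}(x)$ for all $n\ge 0$. Then $x\in\{-3,-2,-1,0\}$ or $x=-\tfrac32$. Moreover, $B^*_{2n+1}\left(-\tfrac32\right)=0$ for all $n\ge 0$. -/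

import Mathlib

/-- The Zagier polynomial `B_n^*(x) = ∑_{r=0}^{n} C(n+r, 2r) B_r(x) / (n+r)`, for `n > 0`, evaluated
at a real number `x`. Here `bernoulliFun r x` is the value at `x` of the `r`-th Bernoulli polynomial
(with `B_1(x) = x - 1/2`). Only indices `n > 0` are meaningful. -/
noncomputable def zagierPoly (n : ℕ) (x : ℝ) : ℝ :=
  ∑ r ∈ Finset.range (n + 1), ((n + r).choose (2 * r) : ℝ) * (bernoulliFun r x / ((n : ℝ) + (r : ℝ)))

/-- A sequence is periodic if it has some positive period: `a (n + p) = a n` for all `n`. -/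
def IsPeriodicSeq (a : ℕ → ℝ) : Prop :=
  ∃ p : ℕ, 0 < p ∧ Function.Periodic a p

/-!
Let `L_z` be the linear functional on polynomials with `L_z(y ^ r) = B_r(z)`. The Zagier polynomial
is a Chebyshev polynomial in umbral disguise: with `C_N(2 cos θ) = 2 cos (N θ)`, one has `2 N
B_N^*(x) = L_{x+2}(C_N)` (`two_mul_zagierPoly`). Put `z = x + 2`. Since `L_{z+1}(f) - L_z(f) =
f'(z)` and `C_N' = N S_{N-1}`, passing from `z` to `z + 1` adds `S_{N-1}(z) / 2` to the value
(`oddZagier_add_one`), and since `C_N` is odd for odd `N`, the reflection `z ↦ 1 - z` changes its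
sign (`oddZagier_one_sub`). In particular the value is zero at `z = 1/2`, that is, at `x = -3/2`.

A periodic sequence is bounded. Expanding powers of `y` in the `C_m` shows that boundedness makes
the odd Bernoulli polynomials `B_k(z)` grow at most exponentially in `k`
(`abs_bernoulliUmbra_X_pow_mul_C_le`). On the other hand the Fourier expansion on `[0, 1]` shows
that, for odd `k`, `(2π) ^ k B_k(z) / k!` approaches `± 2 sin (2πz)`, and this persists for all real
`z` because unit translations change `B_k` by an exponentially bounded amount. Hence `sin (2πz) =
0`, so `2z` is an integer (`exists_int_of_bounded`).

By the reflection, take `z ≥ 1/2`. The value at `z` is then a combination, with fixed positive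
weights, of the `S_{2n}(j)` with `0 ≤ j < z` and `j ≡ z` modulo `1`. The terms with `j < 2` are
bounded and those with `j ≥ 2` are at least `2n + 1`, so boundedness excludes `z ≥ 3`
(`not_bounded_oddZagier`). Of the remaining `z = 1/2, 1, 3/2, 2, 5/2`, the values `3/2` and `5/2`
give bounded sequences that are not periodic: `2 ^ (2n) S_{2n}(j/2)` is an integer congruent to `j ^
(2n)` modulo `4` for odd `j`, so the value at `n = 0` cannot recur.
-/

open Polynomial Filter Topology

/-! ### The umbral functional of the Bernoulli polynomials -/

/-- The linear functional `y ^ r ↦ B_r(z)` on real polynomials. -/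
noncomputable def bernoulliUmbra (z : ℝ) : ℝ[X] →ₗ[ℝ] ℝ :=
  (Polynomial.basisMonomials ℝ).constr ℝ (fun r => bernoulliFun r z)

@[simp]
lemma bernoulliUmbra_X_pow (z : ℝ) (r : ℕ) : bernoulliUmbra z (X ^ r) = bernoulliFun r z := by
  have h := (Polynomial.basisMonomials ℝ).constr_basis ℝ (fun r => bernoulliFun r z) r
  simpa only [bernoulliUmbra, Polynomial.coe_basisMonomials,
    Polynomial.monomial_one_right_eq_X_pow] using h

lemma linearMap_eq_of_X_pow {f g : ℝ[X] →ₗ[ℝ] ℝ} (h : ∀ r : ℕ, f (X ^ r) = g (X ^ r)) : f = g := by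
  refine Polynomial.lhom_ext' fun r => LinearMap.ext_ring ?_
  simpa [Polynomial.monomial_one_right_eq_X_pow] using h r

lemma bernoulliFun_add_one (r : ℕ) (z : ℝ) :
    bernoulliFun r (z + 1) = bernoulliFun r z + r * z ^ (r - 1) := by
  have h := congr_arg (fun p : ℚ[X] => aeval z p) (Polynomial.bernoulli_comp_one_add_X r)
  simpa [bernoulliFun, Polynomial.aeval_comp, add_comm, Polynomial.aeval_def,
    Polynomial.eval_map] using h

lemma sum_choose_mul_bernoulliFun (r : ℕ) (z : ℝ) :
    ∑ k ∈ Finset.range r, (r.choose k : ℝ) * bernoulliFun k z = r * z ^ (r - 1) := by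
  cases r with
  | zero => simp
  | succ r =>
    have h := congr_arg (fun p : ℚ[X] => aeval z p) (Polynomial.sum_bernoulli r)
    simpa [bernoulliFun, Polynomial.aeval_def, Polynomial.eval_map, Algebra.smul_def,
      Polynomial.eval₂_finsetSum, Polynomial.eval₂_mul, add_mul] using h

lemma bernoulliUmbra_add_one (z : ℝ) (f : ℝ[X]) :
    bernoulliUmbra (z + 1) f = bernoulliUmbra z f + (derivative f).eval z := by
  have h : bernoulliUmbra (z + 1) =
      bernoulliUmbra z + (Polynomial.leval z).comp (derivative (R := ℝ)) := by
    refine linearMap_eq_of_X_pow fun r => ?_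
    simp [bernoulliFun_add_one, Polynomial.derivative_X_pow]
  simp [h]

/-- Shifting the variable of the polynomial is the same as shifting the base point: the two
standard recurrences of the Bernoulli polynomials say that both add `f'(z)` to the value. -/
lemma bernoulliUmbra_taylor_one (z : ℝ) (f : ℝ[X]) :
    bernoulliUmbra z (taylor 1 f) = bernoulliUmbra (z + 1) f := by
  have h : (bernoulliUmbra z).comp (taylor 1) = bernoulliUmbra (z + 1) := by
    refine linearMap_eq_of_X_pow fun r => ?_
    have e : taylor 1 ((X : ℝ[X]) ^ r) = ∑ k ∈ Finset.range (r + 1), (r.choose k : ℝ) • X ^ k := by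
      rw [taylor_X_pow, add_pow]
      refine Finset.sum_congr rfl fun k _ => ?_
      simp [Polynomial.smul_eq_C_mul, mul_comm]
    rw [LinearMap.comp_apply, e, map_sum, Finset.sum_range_succ]
    simp only [map_smul, bernoulliUmbra_X_pow, smul_eq_mul, Nat.choose_self, Nat.cast_one, one_mul]
    rw [sum_choose_mul_bernoulliFun, bernoulliFun_add_one, add_comm]
  rw [← h, LinearMap.comp_apply]

lemma bernoulliUmbra_one_sub (z : ℝ) (f : ℝ[X]) :
    bernoulliUmbra (1 - z) f = bernoulliUmbra z (f.comp (-X)) := by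
  have h : bernoulliUmbra (1 - z) =
      (bernoulliUmbra z).comp (Polynomial.aeval (-X : ℝ[X])).toLinearMap := by
    refine linearMap_eq_of_X_pow fun r => ?_
    rcases Nat.even_or_odd r with hr | hr
    · simp [bernoulliFun_eval_one_sub, hr.neg_pow]
    · simp [bernoulliFun_eval_one_sub, hr.neg_pow]
  rw [h]
  simp [Polynomial.aeval_def, Polynomial.comp, Polynomial.algebraMap_eq]

/-! ### Zagier polynomials as umbral Chebyshev polynomials -/

/-- The coefficients of `S_n(y + 2) - S_{n-1}(y + 2)` are the binomials `C(n + r, 2r)`. -/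
lemma coeff_taylor_S_sub_S (n r : ℕ) :
    (taylor 2 (Chebyshev.S ℝ n - Chebyshev.S ℝ (n - 1))).coeff r = ((n + r).choose (2 * r) : ℝ) := by
  induction n using Nat.twoStepInduction generalizing r with
  | zero =>
    rcases r with _ | r
    · simp
    · rw [Nat.choose_eq_zero_of_lt (by omega)]
      simp [Polynomial.coeff_one]
  | one =>
    rcases r with _ | _ | r
    · simp; norm_num
    · simp [Polynomial.coeff_one]
    · rw [Nat.choose_eq_zero_of_lt (by omega)]
      simp [Polynomial.coeff_one, Polynomial.coeff_X]
  | more n h0 h1 =>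
    have key : taylor 2 (Chebyshev.S ℝ ((n + 2 : ℕ) : ℤ) - Chebyshev.S ℝ ((n + 2 : ℕ) - 1)) =
        (X + C 2) * taylor 2 (Chebyshev.S ℝ ((n + 1 : ℕ) : ℤ) - Chebyshev.S ℝ ((n + 1 : ℕ) - 1)) -
          taylor 2 (Chebyshev.S ℝ (n : ℤ) - Chebyshev.S ℝ (n - 1)) := by
      have e1 := Chebyshev.S_add_two ℝ n
      have e2 := Chebyshev.S_add_one ℝ n
      have : Chebyshev.S ℝ ((n + 2 : ℕ) : ℤ) - Chebyshev.S ℝ ((n + 2 : ℕ) - 1) =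
          X * (Chebyshev.S ℝ ((n + 1 : ℕ) : ℤ) - Chebyshev.S ℝ ((n + 1 : ℕ) - 1)) -
          (Chebyshev.S ℝ (n : ℤ) - Chebyshev.S ℝ (n - 1)) := by
        push_cast
        rw [show (n : ℤ) + 2 - 1 = n + 1 by ring, show (n : ℤ) + 1 - 1 = n by ring, e1]
        linear_combination -e2
      rw [this, map_sub, taylor_mul, taylor_X]
    rw [key, coeff_sub, h0, add_mul, coeff_add, coeff_C_mul, h1]
    rcases r with _ | r
    · simp; norm_num
    · rw [coeff_X_mul, h1]
      have p1 : (n + 2 + (r + 1)).choose (2 * (r + 1)) + (n + (r + 1)).choose (2 * (r + 1)) =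
          (n + 1 + r).choose (2 * r) + 2 * (n + 1 + (r + 1)).choose (2 * (r + 1)) := by
        rw [show n + 2 + (r + 1) = (n + r + 2) + 1 by ring, show 2 * (r + 1) = (2 * r + 1) + 1 by ring,
          show n + 1 + (r + 1) = (n + r + 1) + 1 by ring, show n + (r + 1) = n + r + 1 by ring,
          show n + 1 + r = n + r + 1 by ring, Nat.choose_succ_succ (n + r + 2),
          show n + r + 2 = (n + r + 1) + 1 by ring, Nat.choose_succ_succ (n + r + 1) (2 * r + 1),
          Nat.choose_succ_succ (n + r + 1) (2 * r)]
        ring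
      have p2 : ((n + 2 + (r + 1)).choose (2 * (r + 1)) : ℝ) + (n + (r + 1)).choose (2 * (r + 1)) =
          (n + 1 + r).choose (2 * r) + 2 * (n + 1 + (r + 1)).choose (2 * (r + 1)) := by
        exact_mod_cast p1
      linear_combination -p2

/-- The coefficients of `C_N(y + 2)` for `N = n + 1`, obtained from `C_N = S_N - S_{N-2}`; they are
`2N` times those in the definition of the Zagier polynomial. -/
lemma coeff_taylor_C (n r : ℕ) :
    (taylor 2 (Chebyshev.C ℝ ((n + 1 : ℕ) : ℤ))).coeff r =
      2 * (n + 1) * ((n + 1 + r).choose (2 * r) / ((n + 1 : ℕ) + r : ℝ)) := by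
  have e : Chebyshev.C ℝ ((n + 1 : ℕ) : ℤ) =
      (Chebyshev.S ℝ ((n + 1 : ℕ) : ℤ) - Chebyshev.S ℝ ((n + 1 : ℕ) - 1)) +
        (Chebyshev.S ℝ (n : ℤ) - Chebyshev.S ℝ (n - 1)) := by
    have e2 := Chebyshev.S_add_one ℝ n
    rw [Chebyshev.C_eq_S_sub_X_mul_S]
    push_cast
    rw [show (n : ℤ) + 1 - 1 = n by ring]
    linear_combination e2
  rw [e, map_add, coeff_add, coeff_taylor_S_sub_S, coeff_taylor_S_sub_S]
  have h : (n + 1 + r).choose (2 * r) * (n + 1 + r - 2 * r) = (n + 1 + r) * (n + r).choose (2 * r) := by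
    have := Nat.choose_mul_succ_eq (n + r) (2 * r)
    rw [show n + 1 + r = n + r + 1 by ring, ← this, mul_comm]
  have h' : ((n + 1 + r).choose (2 * r) : ℝ) * (n + 1 - r) = (n + 1 + r) * (n + r).choose (2 * r) := by
    rcases le_or_gt r (n + 1) with hr | hr
    · have h2 : ((n + 1 + r - 2 * r : ℕ) : ℝ) = n + 1 - r := by
        rw [Nat.cast_sub (by omega)]; push_cast; ring
      rw [← h2]; exact_mod_cast h
    · rw [Nat.choose_eq_zero_of_lt (by omega), Nat.choose_eq_zero_of_lt (by omega)]; simp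
  have hne : ((n : ℝ) + 1 + r) ≠ 0 := by positivity
  push_cast
  field_simp
  linear_combination -h'

/-- `B_N^*(x)` is, up to the factor `1 / (2N)`, the umbral value of the Chebyshev polynomial
`C_N(2 cos θ) = 2 cos (N θ)` at the base point `x + 2`. -/
lemma two_mul_zagierPoly (n : ℕ) (x : ℝ) :
    2 * (n + 1) * zagierPoly (n + 1) x =
      bernoulliUmbra (x + 2) (Chebyshev.C ℝ ((n + 1 : ℕ) : ℤ)) := by
  have hs : x + 2 = x + 1 + 1 := by ring
  rw [hs, ← bernoulliUmbra_taylor_one, ← bernoulliUmbra_taylor_one, taylor_taylor]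
  norm_num only
  set P := taylor 2 (Chebyshev.C ℝ ((n + 1 : ℕ) : ℤ)) with hP
  have hdeg : P.natDegree < n + 1 + 1 := by
    rw [Nat.lt_succ_iff, Polynomial.natDegree_le_iff_coeff_eq_zero]
    intro r hr
    rw [hP, coeff_taylor_C, Nat.choose_eq_zero_of_lt (by omega)]
    simp
  rw [P.as_sum_range' _ hdeg, map_sum, zagierPoly, Finset.mul_sum]
  refine Finset.sum_congr rfl fun r _ => ?_
  rw [← Polynomial.C_mul_X_pow_eq_monomial, ← Polynomial.smul_eq_C_mul, map_smul,
    bernoulliUmbra_X_pow, hP, coeff_taylor_C, smul_eq_mul]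
  ring

lemma derivative_chebyshev_C (n : ℤ) : derivative (Chebyshev.C ℝ n) = n * Chebyshev.S ℝ (n - 1) := by
  rw [Chebyshev.C_eq_two_mul_T_comp_half_mul_X, Chebyshev.S_eq_U_comp_half_mul_X]
  simp only [derivative_mul, derivative_ofNat, derivative_comp, Chebyshev.T_derivative_eq_U,
    Polynomial.derivative_C, derivative_X, mul_comp, intCast_comp]
  have : (2 : ℝ[X]) * C ⅟2 = 1 := by
    rw [← map_ofNat C 2, ← C_mul, mul_invOf_self', map_one]
  linear_combination (n * (Chebyshev.U ℝ (n - 1)).comp (C ⅟2 * X)) * this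

/-- The value `B_{2n+1}^*(z - 2)`. In terms of `z`, the reflection `z ↦ 1 - z` becomes an odd
symmetry. -/
noncomputable def oddZagier (n : ℕ) (z : ℝ) : ℝ := zagierPoly (2 * n + 1) (z - 2)

lemma oddZagier_eq (n : ℕ) (z : ℝ) :
    2 * (2 * n + 1) * oddZagier n z = bernoulliUmbra z (Chebyshev.C ℝ (2 * n + 1)) := by
  have h := two_mul_zagierPoly (2 * n) (z - 2)
  rw [sub_add_cancel] at h
  push_cast at h
  exact h

lemma oddZagier_add_one (n : ℕ) (z : ℝ) :
    oddZagier n (z + 1) = oddZagier n z + (Chebyshev.S ℝ (2 * n)).eval z / 2 := by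
  have h := oddZagier_eq n (z + 1)
  rw [bernoulliUmbra_add_one, ← oddZagier_eq, derivative_chebyshev_C] at h
  rw [eval_mul, add_sub_cancel_right] at h
  have hn : (2 * n + 1 : ℝ) ≠ 0 := by positivity
  simp only [Int.cast_add, Int.cast_mul, Int.cast_ofNat, Int.cast_natCast, Int.cast_one, eval_add,
    eval_mul, eval_ofNat, eval_natCast, eval_one] at h
  apply mul_left_cancel₀ hn
  linear_combination h / 2

lemma oddZagier_one_sub (n : ℕ) (z : ℝ) : oddZagier n (1 - z) = -oddZagier n z := by
  have h := oddZagier_eq n (1 - z)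
  have hc : (Chebyshev.C ℝ (2 * n + 1)).comp (-X) = -Chebyshev.C ℝ (2 * n + 1) := by
    refine Polynomial.funext fun t => ?_
    have hodd : ((2 * n + 1 : ℤ).negOnePow : ℤ) = -1 := by
      rw [Int.negOnePow_odd _ (odd_two_mul_add_one _)]; simp
    simp only [Chebyshev.C_eq_two_mul_T_comp_half_mul_X, eval_comp, eval_mul, eval_neg, eval_C,
      eval_X, mul_neg, Chebyshev.T_eval_neg, hodd]
    simp
  rw [bernoulliUmbra_one_sub, hc, map_neg, ← oddZagier_eq] at h
  have hn : (2 * (2 * n + 1) : ℝ) ≠ 0 := by positivity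
  apply mul_left_cancel₀ hn
  linear_combination h

lemma oddZagier_half (n : ℕ) : oddZagier n (1 / 2) = 0 := by
  have h := oddZagier_one_sub n (1 / 2)
  norm_num at h
  linarith

lemma oddZagier_one (n : ℕ) : oddZagier n 1 = (Chebyshev.S ℝ (2 * n)).eval 0 / 4 := by
  have h := oddZagier_one_sub n 1
  have h' := oddZagier_add_one n 0
  rw [sub_self] at h
  rw [zero_add] at h'
  linarith

/-! ### Growth of the Bernoulli polynomials -/

/-- If the umbral values of the odd-index Chebyshev polynomials grow at most linearly, then the odd
Bernoulli polynomials grow at most exponentially: multiplication by `y` sends `C_m` to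
`C_{m+1} + C_{m-1}`. -/
lemma abs_bernoulliUmbra_X_pow_mul_C_le {z K : ℝ}
    (h : ∀ m : ℤ, Odd m → |bernoulliUmbra z (Chebyshev.C ℝ m)| ≤ K * |(m : ℝ)|) (hK : 0 ≤ K)
    (k : ℕ) (m : ℤ) (hkm : Odd (k + m)) :
    |bernoulliUmbra z (X ^ k * Chebyshev.C ℝ m)| ≤ 2 ^ k * (K * (|(m : ℝ)| + k)) := by
  induction k generalizing m with
  | zero => simpa using h m (by simpa using hkm)
  | succ k ih =>
    have e : (X : ℝ[X]) ^ (k + 1) * Chebyshev.C ℝ m =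
        X ^ k * Chebyshev.C ℝ (m + 1) + X ^ k * Chebyshev.C ℝ (m - 1) := by
      rw [Chebyshev.C_add_one]; ring
    rw [e, map_add]
    have h1 := ih (m + 1) (by
      rwa [show (k : ℤ) + (m + 1) = (k + 1 : ℕ) + m by push_cast; ring])
    have h2 := ih (m - 1) (by
      rw [show (k : ℤ) + (m - 1) = ((k + 1 : ℕ) + m) - 2 by push_cast; ring]
      exact hkm.sub_even even_two)
    refine (abs_add_le _ _).trans ((add_le_add h1 h2).trans ?_)
    have a1 : |((m + 1 : ℤ) : ℝ)| ≤ |(m : ℝ)| + 1 := by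
      push_cast; exact (abs_add_le _ _).trans (by simp)
    have a2 : |((m - 1 : ℤ) : ℝ)| ≤ |(m : ℝ)| + 1 := by
      push_cast; exact (abs_sub _ _).trans (by simp)
    have b1 := mul_le_mul_of_nonneg_left a1 hK
    have b2 := mul_le_mul_of_nonneg_left a2 hK
    rw [← mul_add, pow_succ, mul_assoc]
    refine mul_le_mul_of_nonneg_left ?_ (by positivity)
    push_cast at b1 b2 ⊢
    linarith

/-- The condition that the odd Bernoulli polynomials at `z` grow slower than
`(2m+1)! / (2π)^(2m+1)`. -/
def SlowOddBernoulli (z : ℝ) : Prop :=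
  Tendsto (fun m : ℕ => (2 * Real.pi) ^ (2 * m + 1) / ((2 * m + 1).factorial : ℝ) *
    bernoulliFun (2 * m + 1) z) atTop (𝓝 0)

lemma tendsto_odd_index {f : ℕ → ℝ} (h : Tendsto f atTop (𝓝 0)) :
    Tendsto (fun m => f (2 * m + 1)) atTop (𝓝 0) :=
  h.comp (tendsto_atTop_mono (fun m => by simp only [id]; omega) tendsto_id)

/-- Translations by `1` change `B_{2m+1}` only by an exponentially bounded term. -/
lemma slowOddBernoulli_add_one_iff (z : ℝ) : SlowOddBernoulli (z + 1) ↔ SlowOddBernoulli z := by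
  have key : Tendsto (fun m : ℕ => (2 * Real.pi) ^ (2 * m + 1) / ((2 * m + 1).factorial : ℝ) *
      (((2 * m + 1 : ℕ) : ℝ) * z ^ (2 * m))) atTop (𝓝 0) := by
    have h := (FloorSemiring.tendsto_pow_div_factorial_atTop (2 * Real.pi * z)).comp
      (tendsto_atTop_mono (fun m => by simp only [id]; omega : ∀ m : ℕ, id m ≤ 2 * m) tendsto_id)
    have h := h.const_mul (2 * Real.pi)
    rw [mul_zero] at h
    refine h.congr fun m => ?_
    simp only [Function.comp]
    rw [Nat.factorial_succ, mul_pow]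
    have : ((2 * m).factorial : ℝ) ≠ 0 := by positivity
    push_cast
    have : (2 * m + 1 : ℝ) ≠ 0 := by positivity
    field_simp
    ring
  unfold SlowOddBernoulli
  simp only [bernoulliFun_add_one, mul_add, Nat.add_sub_cancel]
  constructor
  · intro h
    simpa using h.sub key
  · intro h
    simpa using h.add key

lemma slowOddBernoulli_fract_iff (z : ℝ) : SlowOddBernoulli (Int.fract z) ↔ SlowOddBernoulli z := by
  have h : Function.Periodic SlowOddBernoulli 1 := fun z => propext (slowOddBernoulli_add_one_iff z)
  rw [Int.fract, ← mul_one (⌊z⌋ : ℝ), h.sub_int_mul_eq]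

/-- In the Fourier expansion of `B_{2m+1}`, the first harmonic dominates as `m → ∞`. -/
lemma tendsto_tsum_sin (z : ℝ) :
    Tendsto (fun k : ℕ => ∑' n : ℕ, 1 / (n : ℝ) ^ (2 * k + 1) * Real.sin (2 * Real.pi * n * z))
      atTop (𝓝 (Real.sin (2 * Real.pi * z))) := by
  have hs : ∑' n : ℕ, (if n = 1 then Real.sin (2 * Real.pi * z) else 0) =
      Real.sin (2 * Real.pi * z) := by
    rw [tsum_ite_eq]
  rw [← hs]
  refine tendsto_tsum_of_dominated_convergence (bound := fun n : ℕ => 1 / (n : ℝ) ^ 2)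
    (Real.summable_one_div_nat_pow.2 one_lt_two) (fun n => ?_) ?_
  · rcases n with _ | _ | n
    · simp
    · simp
    · have h1 : (1 : ℝ) < ((n + 2 : ℕ) : ℝ) := by push_cast; linarith [n.cast_nonneg (α := ℝ)]
      have h := tendsto_odd_index (tendsto_pow_atTop_nhds_zero_of_lt_one
        (r := 1 / ((n + 2 : ℕ) : ℝ)) (by positivity) ((div_lt_one (by linarith)).2 h1))
      have h := h.mul_const (Real.sin (2 * Real.pi * (n + 2 : ℕ) * z))
      simpa [one_div, add_assoc, one_add_one_eq_two] using h
  · filter_upwards [eventually_ge_atTop 1] with k hk n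
    rcases Nat.eq_zero_or_pos n with rfl | hn
    · simp
    · rw [norm_mul, Real.norm_eq_abs, Real.norm_eq_abs, abs_of_nonneg (by positivity)]
      have h1 : (1 : ℝ) ≤ n := by exact_mod_cast hn
      calc 1 / (n : ℝ) ^ (2 * k + 1) * |Real.sin (2 * Real.pi * n * z)|
          ≤ 1 / (n : ℝ) ^ (2 * k + 1) * 1 := by gcongr; exact Real.abs_sin_le_one _
        _ ≤ 1 / (n : ℝ) ^ 2 := by rw [mul_one]; gcongr; omega

lemma sin_two_pi_mul_eq_zero_of_slowOddBernoulli {z : ℝ} (h : SlowOddBernoulli z) :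
    Real.sin (2 * Real.pi * z) = 0 := by
  have h' := (slowOddBernoulli_fract_iff z).2 h
  have e : Real.sin (2 * Real.pi * Int.fract z) = Real.sin (2 * Real.pi * z) := by
    rw [Int.fract, mul_sub, mul_comm (2 * Real.pi) (⌊z⌋ : ℝ), Real.sin_sub_int_mul_two_pi]
  rw [← e]
  refine tendsto_nhds_unique (tendsto_tsum_sin _) ?_
  rw [tendsto_zero_iff_abs_tendsto_zero]
  have h2 := ((tendsto_zero_iff_abs_tendsto_zero _).1 h').div_const 2
  rw [zero_div] at h2
  refine h2.congr' ?_
  filter_upwards [eventually_ge_atTop 1] with k hk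
  have hsum := hasSum_one_div_nat_pow_mul_sin (k := k) (by omega)
    ⟨Int.fract_nonneg z, (Int.fract_lt_one z).le⟩
  simp only [Function.comp]
  rw [hsum.tsum_eq, bernoulliFun]
  simp only [abs_mul, abs_div, abs_pow, abs_neg, abs_one, one_pow]
  rw [abs_two]
  ring

/-- Boundedness of the sequence already forces `2z` to be an integer. -/
lemma exists_int_of_bounded {z B : ℝ} (h : ∀ n, |oddZagier n z| ≤ B) : ∃ k : ℤ, 2 * z = k := by
  have hB : 0 ≤ B := (abs_nonneg _).trans (h 0)
  have hC : ∀ m : ℤ, Odd m → |bernoulliUmbra z (Chebyshev.C ℝ m)| ≤ (2 * B) * |(m : ℝ)| := by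
    intro m hm
    rw [← Chebyshev.C_natAbs]
    obtain ⟨n, hn⟩ := Int.natAbs_odd.2 hm
    have hcast : |(m : ℝ)| = 2 * n + 1 := by
      rw [← Int.cast_abs, Int.abs_eq_natAbs, hn]; push_cast; ring
    rw [hcast, hn]
    push_cast
    rw [← oddZagier_eq, abs_mul, abs_of_pos (by positivity : (0 : ℝ) < 2 * (2 * n + 1))]
    nlinarith [h n, mul_le_mul_of_nonneg_left (h n) (by positivity : (0 : ℝ) ≤ 2 * (2 * n + 1))]
  have hb : ∀ m : ℕ, |bernoulliFun (2 * m + 1) z| ≤ 2 ^ (2 * m) * ((2 * B) * (2 * m + 1)) := by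
    intro m
    have := abs_bernoulliUmbra_X_pow_mul_C_le hC (by positivity) (2 * m) 1
      (by push_cast; exact odd_two_mul_add_one _)
    rw [Chebyshev.C_one, ← pow_succ, bernoulliUmbra_X_pow] at this
    simpa [add_comm] using this
  have hslow : SlowOddBernoulli z := by
    have hl := (FloorSemiring.tendsto_pow_div_factorial_atTop (2 * (2 * Real.pi))).comp
      (tendsto_atTop_mono (fun m => by simp only [id]; omega : ∀ m : ℕ, id m ≤ 2 * m) tendsto_id)
    have hl := hl.const_mul (4 * Real.pi * B)
    rw [mul_zero] at hl
    refine squeeze_zero_norm (fun m => ?_) hl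
    rw [norm_mul, Real.norm_eq_abs, Real.norm_eq_abs, abs_of_pos (by positivity)]
    refine (mul_le_mul_of_nonneg_left (hb m) (by positivity)).trans (le_of_eq ?_)
    simp only [Function.comp]
    rw [Nat.factorial_succ, mul_pow 2 (2 * Real.pi)]
    push_cast
    have : (2 * m + 1 : ℝ) ≠ 0 := by positivity
    field_simp
    ring
  obtain ⟨k, hk⟩ := Real.sin_eq_zero_iff.1 (sin_two_pi_mul_eq_zero_of_slowOddBernoulli hslow)
  refine ⟨k, mul_left_cancel₀ Real.pi_ne_zero ?_⟩
  linear_combination -hk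

/-! ### Values of the Chebyshev polynomials of the second kind -/

lemma le_eval_S {y : ℝ} (hy : 2 ≤ y) (n : ℕ) : (n + 1 : ℝ) ≤ (Chebyshev.S ℝ n).eval y := by
  have key : ∀ n : ℕ, (n + 1 : ℝ) ≤ (Chebyshev.S ℝ n).eval y ∧
      (Chebyshev.S ℝ n).eval y + 1 ≤ (Chebyshev.S ℝ (n + 1)).eval y := by
    intro n
    induction n with
    | zero => simp; linarith
    | succ n ih =>
      obtain ⟨h1, h2⟩ := ih
      have e : (Chebyshev.S ℝ (n + 2)).eval y =
          y * (Chebyshev.S ℝ (n + 1)).eval y - (Chebyshev.S ℝ n).eval y := by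
        rw [Chebyshev.S_add_two]; simp
      push_cast
      rw [show (n : ℤ) + 1 + 1 = n + 2 by ring, e]
      have h0 : (0 : ℝ) ≤ n := n.cast_nonneg
      exact ⟨by linarith, by nlinarith⟩
  exact (key n).1

/-- The points `2 cos θ` with `0 < θ < π` give bounded sequences. -/
lemma abs_eval_S_le {y : ℝ} (hy : |y| < 2) : ∃ B : ℝ, ∀ n : ℤ, |(Chebyshev.S ℝ n).eval y| ≤ B := by
  have hy2 : 0 < 1 - y ^ 2 / 4 := by
    have := sq_lt_sq' (by linarith [abs_nonneg y]) hy
    rw [sq_abs] at this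
    linarith
  refine ⟨1 + 1 / (1 - y ^ 2 / 4), fun n => ?_⟩
  have h := congr_arg (eval y) (Chebyshev.S_sq_add_S_sq ℝ n)
  simp only [eval_add, eval_sub, eval_mul, eval_pow, eval_X, eval_one] at h
  set s := (Chebyshev.S ℝ n).eval y
  set t := (Chebyshev.S ℝ (n + 1)).eval y
  -- complete the square in the invariant `s ^ 2 + t ^ 2 - y s t = 1`
  have h1 : (1 - y ^ 2 / 4) * s ^ 2 ≤ 1 := by nlinarith [sq_nonneg (t - y * s / 2)]
  have h2 : s ^ 2 ≤ 1 / (1 - y ^ 2 / 4) := by rwa [le_div_iff₀' hy2]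
  have h3 : |s| ≤ 1 + s ^ 2 := by rw [← sq_abs]; nlinarith [sq_nonneg (|s| - 1), abs_nonneg s]
  linarith

/-- For odd `j`, the integer `2^n S_n(j/2)` is congruent to `j^n` modulo `4`. -/
lemma exists_int_two_pow_mul_eval_S (j : ℤ) (n : ℕ) :
    ∃ v : ℤ, (2 : ℝ) ^ n * (Chebyshev.S ℝ n).eval (j / 2 : ℝ) = v ∧ 4 ∣ v - j ^ n := by
  induction n using Nat.twoStepInduction with
  | zero => exact ⟨1, by simp, by simp⟩
  | one => exact ⟨j, by simp; ring, by simp⟩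
  | more n h0 h1 =>
    obtain ⟨u, hu, du⟩ := h0
    obtain ⟨v, hv, dv⟩ := h1
    refine ⟨j * v - 4 * u, ?_, ?_⟩
    · push_cast at hv ⊢
      rw [Chebyshev.S_add_two, ← hu, ← hv]
      simp
      ring
    · have : j * v - 4 * u - j ^ (n + 2) = j * (v - j ^ (n + 1)) - 4 * u := by ring
      rw [this]
      exact dvd_sub (dv.mul_left _) (dvd_mul_right _ _)

/-! ### Boundedness and periodicity at integers and half-integers -/

lemma bounded_oddZagier_add_one {z : ℝ} (hz : |z| < 2) (h : ∃ B, ∀ n, |oddZagier n z| ≤ B) :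
    ∃ B, ∀ n, |oddZagier n (z + 1)| ≤ B := by
  obtain ⟨B, hB⟩ := h
  obtain ⟨B', hB'⟩ := abs_eval_S_le hz
  refine ⟨B + B' / 2, fun n => ?_⟩
  rw [oddZagier_add_one]
  refine (abs_add_le _ _).trans (add_le_add (hB n) ?_)
  rw [abs_div, abs_two]
  linarith [hB' (2 * n)]

/-- Past the point `2` each unit step adds at least `(2n + 1) / 2`, so boundedness is lost. -/
lemma not_bounded_oddZagier {z : ℝ} (hz : 2 ≤ z) (h : ∃ B, ∀ n, |oddZagier n z| ≤ B) (N : ℕ) :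
    ¬ ∃ B, ∀ n, |oddZagier n (z + (N + 1 : ℕ))| ≤ B := by
  rintro ⟨B', hB'⟩
  obtain ⟨B, hB⟩ := h
  have key : ∀ (N n : ℕ), -B + (2 * n + 1) / 2 ≤ oddZagier n (z + (N + 1 : ℕ)) := by
    intro N n
    induction N with
    | zero =>
      have := le_eval_S hz (2 * n)
      push_cast at this
      rw [zero_add, Nat.cast_one, oddZagier_add_one]
      linarith [(abs_le.1 (hB n)).1]
    | succ N ih =>
      have hz' : 2 ≤ z + (N + 1 : ℕ) := by linarith [(N + 1).cast_nonneg (α := ℝ)]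
      have := le_eval_S hz' (2 * n)
      rw [Nat.cast_succ (N + 1), ← add_assoc, oddZagier_add_one]
      push_cast at this ih ⊢
      linarith [n.cast_nonneg (α := ℝ)]
  obtain ⟨n, hn⟩ := exists_nat_gt (B' + B)
  linarith [key N n, (abs_le.1 (hB' n)).2]

lemma bounded_of_isPeriodicSeq {a : ℕ → ℝ} (h : IsPeriodicSeq a) : ∃ B, ∀ n, |a n| ≤ B := by
  obtain ⟨p, hp, ha⟩ := h
  refine ⟨∑ i ∈ Finset.range p, |a i|, fun n => ?_⟩
  rw [← ha.map_mod_nat n]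
  exact Finset.single_le_sum (f := fun i => |a i|) (fun i _ => abs_nonneg _)
    (Finset.mem_range.2 (Nat.mod_lt _ hp))

lemma not_isPeriodicSeq_three_halves : ¬ IsPeriodicSeq (fun n => oddZagier n (3 / 2)) := by
  rintro ⟨p, hp, h⟩
  have h0 := h 0
  simp only [zero_add] at h0
  rw [show (3 / 2 : ℝ) = 1 / 2 + 1 by norm_num, oddZagier_add_one, oddZagier_add_one,
    oddZagier_half, oddZagier_half] at h0
  obtain ⟨v, hv, dv⟩ := exists_int_two_pow_mul_eval_S 1 (2 * p)
  push_cast at hv h0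
  simp at h0
  have hv' : (2 : ℤ) ^ (2 * p) = v := by
    rify
    rw [← hv, one_div]
    linear_combination -2 * 2 ^ (2 * p) * h0
  obtain ⟨q, rfl⟩ : ∃ q, p = q + 1 := ⟨p - 1, by omega⟩
  rw [← hv', show 2 * (q + 1) = 2 * q + 2 by ring, pow_add] at dv
  simp at dv
  omega

lemma not_isPeriodicSeq_five_halves : ¬ IsPeriodicSeq (fun n => oddZagier n (5 / 2)) := by
  rintro ⟨p, hp, h⟩
  have h0 := h 0
  simp only [zero_add] at h0
  rw [show (5 / 2 : ℝ) = 1 / 2 + 1 + 1 by norm_num, oddZagier_add_one, oddZagier_add_one,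
    oddZagier_add_one, oddZagier_add_one, oddZagier_half, oddZagier_half] at h0
  obtain ⟨u, hu, du⟩ := exists_int_two_pow_mul_eval_S 1 (2 * p)
  obtain ⟨v, hv, dv⟩ := exists_int_two_pow_mul_eval_S 3 (2 * p)
  rw [show (1 / 2 + 1 : ℝ) = 3 / 2 by norm_num] at h0
  push_cast at hu hv h0
  norm_num at h0
  have huv : 2 * (2 : ℤ) ^ (2 * p) = u + v := by
    rify
    rw [← hu, ← hv]
    linear_combination -2 * 2 ^ (2 * p) * h0
  obtain ⟨q, rfl⟩ : ∃ q, p = q + 1 := ⟨p - 1, by omega⟩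
  -- modulo `4`, the right side of `huv` is `1 + 3 ^ (2p) ≡ 2`, while the left side vanishes
  have d3 : (4 : ℤ) ∣ 3 ^ (2 * (q + 1)) - 1 := by
    rw [pow_mul]
    exact (by norm_num : (4 : ℤ) ∣ 3 ^ 2 - 1).trans (sub_one_dvd_pow_sub_one _ _)
  rw [show 2 * (q + 1) = 2 * q + 2 by ring, pow_add] at huv
  simp at du
  omega

lemma eq_of_isPeriodicSeq_of_half_le {z : ℝ} (hz : 1 / 2 ≤ z)
    (h : IsPeriodicSeq (fun n => oddZagier n z)) : z = 1 / 2 ∨ z = 1 ∨ z = 2 := by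
  obtain ⟨B, hB⟩ := bounded_of_isPeriodicSeq h
  obtain ⟨k, hk⟩ := exists_int_of_bounded hB
  have hk1 : 1 ≤ k := by
    have : (1 : ℝ) ≤ k := by linarith
    exact_mod_cast this
  have half : ∃ B, ∀ n, |oddZagier n (1 / 2)| ≤ B := ⟨0, fun n => by rw [oddZagier_half, abs_zero]⟩
  have three_halves := bounded_oddZagier_add_one (by rw [abs_of_pos] <;> norm_num) half
  have five_halves := bounded_oddZagier_add_one (by rw [abs_of_pos] <;> norm_num) three_halves
  have one : ∃ B, ∀ n, |oddZagier n 1| ≤ B := by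
    obtain ⟨B, hB⟩ := abs_eval_S_le (y := 0) (by simp)
    refine ⟨B / 4, fun n => ?_⟩
    rw [oddZagier_one, abs_div, abs_of_pos (by norm_num : (0 : ℝ) < 4)]
    linarith [hB (2 * n)]
  have two := bounded_oddZagier_add_one (by rw [abs_of_pos] <;> norm_num) one
  rcases Int.even_or_odd' k with ⟨m, rfl | rfl⟩
  · have hzm : z = m := by push_cast at hk; linarith
    rcases (by omega : m = 1 ∨ m = 2 ∨ 3 ≤ m) with rfl | rfl | hm
    · right; left; simpa using hzm
    · right; right; simpa using hzm
    · exfalso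
      obtain ⟨N, rfl⟩ : ∃ N : ℕ, m = 2 + (N + 1) := ⟨(m - 3).toNat, by omega⟩
      refine not_bounded_oddZagier (by norm_num) two N ⟨B, ?_⟩
      rw [show (1 + 1 + (N + 1 : ℕ) : ℝ) = z by rw [hzm]; push_cast; ring]
      exact hB
  · have hzm : z = m + 1 / 2 := by push_cast at hk; linarith
    rcases (by omega : m = 0 ∨ m = 1 ∨ m = 2 ∨ 3 ≤ m) with rfl | rfl | rfl | hm
    · left; simpa using hzm
    · exfalso
      rw [show z = 3 / 2 by rw [hzm]; norm_num] at h
      exact not_isPeriodicSeq_three_halves h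
    · exfalso
      rw [show z = 5 / 2 by rw [hzm]; norm_num] at h
      exact not_isPeriodicSeq_five_halves h
    · exfalso
      obtain ⟨N, rfl⟩ : ∃ N : ℕ, m = 2 + (N + 1) := ⟨(m - 3).toNat, by omega⟩
      refine not_bounded_oddZagier (by norm_num) five_halves N ⟨B, ?_⟩
      rw [show (1 / 2 + 1 + 1 + (N + 1 : ℕ) : ℝ) = z by rw [hzm]; push_cast; ring]
      exact hB

theorem theorem1p2 :
    (∀ x : ℝ, IsPeriodicSeq (fun n : ℕ => zagierPoly (2 * n + 1) x) →
      x ∈ ({-3, -2, -1, 0} : Set ℝ) ∨ x = -3 / 2) ∧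
    (∀ n : ℕ, zagierPoly (2 * n + 1) (-3 / 2) = 0) := by
  refine ⟨fun x hx => ?_, fun n => ?_⟩
  · have h : IsPeriodicSeq (fun n => oddZagier n (x + 2)) := by
      simpa [oddZagier] using hx
    simp only [Set.mem_insert_iff, Set.mem_singleton_iff]
    rcases le_total (1 / 2) (x + 2) with hz | hz
    · rcases eq_of_isPeriodicSeq_of_half_le hz h with h | h | h
      · right; linarith
      · left; right; right; left; linarith
      · left; right; right; right; linarith
    · have h' : IsPeriodicSeq (fun n => oddZagier n (1 - (x + 2))) := by
        obtain ⟨p, hp, hper⟩ := h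
        refine ⟨p, hp, fun n => ?_⟩
        have := hper n
        simp only [oddZagier_one_sub] at this ⊢
        rw [this]
      rcases eq_of_isPeriodicSeq_of_half_le (by linarith) h' with h | h | h
      · right; linarith
      · left; right; left; linarith
      · left; left; linarith
  · have h := oddZagier_half n
    rwa [oddZagier, show (1 / 2 - 2 : ℝ) = -3 / 2 by norm_num] at h
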